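/- Let $p$ be a prime and let $G$ be a group of order $p^n$ and exponent $p^e$. Let $s \ge 2$ and let $A \le G$ be maximal, with respect to inclusion, among the normal abelian subgroups of $G$ having exponent (exactly) $p^s$. If $|A| = p^r$, then \[ n \le \tfrac12 (r-s+1)(r-s+2e-2) + r, \] and also \[ r \ge -\left(e-s+\tfrac12\right) + \sqrt{\left(e-s+\tfrac12\right)^2 + 2n}. \] -/

import Mathlib

/-- `IsMaximalNormalAbelianOfExponent A m`: the subgroup `A` is maximal, with respect to inclusion,
among the normal abelian subgroups of `G` whose exponent is (exactly) `m`. -/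
def IsMaximalNormalAbelianOfExponent {G : Type*} [Group G] (A : Subgroup G) (m : ℕ) : Prop :=
  Maximal (fun B : Subgroup G => B.Normal ∧ IsMulCommutative B ∧ Monoid.exponent B = m) A

open Subgroup

/-! Let `C` be the centralizer of `A`; then `|G| = |G : C| |C|`, and both factors are bounded. Write
`|A^p| = p^m` and let `p^d` be the number of solutions of `a^p = 1` in `A`, so `m + d = r` and `s ≤
m + 1`. Index: climbing from `A^p` to `A` by `d` normal steps of order `p`, each new generator has
at most as many conjugates as the order of the subgroup below it. These generators alone generate
`A`, so `|G : C| ≤ p^(∑ i < d, (m + i))`. Order: by Alperin's theorem `C` has no elements of order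
dividing `p^s` outside `A`. Those of order dividing `p^2` are then central in `C`, which forces
fibres of `x ↦ x^p` on `C` to have at most `p^d` elements (`IsPGroup.div_pow_eq_one_of_pow_eq`).
Going from exponent `p^s` up to `p^e` gives `|C| ≤ p^(d(e-s) + r)`. -/

/-! ### Elements with equal `p`-th powers. -/

theorem mul_pow_of_central_commutator {G : Type*} [Group G] {x y z : G} (h : y * x = x * y * z)
    (hx : Commute z x) (hy : Commute z y) (n : ℕ) :
    (x * y) ^ n = x ^ n * y ^ n * z ^ (n.choose 2) := by
  have hyn (n : ℕ) : y ^ n * x = x * y ^ n * z ^ n := by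
    induction n with
    | zero => simp
    | succ n ih =>
      calc y ^ (n + 1) * x = y ^ n * (y * x) := by group
        _ = (y ^ n * x) * (y * z) := by rw [h]; group
        _ = x * y ^ n * (z ^ n * y) * z := by rw [ih]; group
        _ = x * y ^ n * (y * z ^ n) * z := by rw [(hy.pow_left n).eq]
        _ = _ := by rw [pow_succ, pow_succ]; group
  induction n with
  | zero => simp
  | succ n ih =>
    have h2 : (n + 1).choose 2 = n + n.choose 2 := by
      rw [Nat.choose_succ_succ', Nat.choose_one_right]
    have hzx := (hx.pow_left (n.choose 2)).eq
    have hzy := (hy.pow_left (n + n.choose 2)).eq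
    calc (x * y) ^ (n + 1) = x ^ n * y ^ n * (z ^ n.choose 2 * x) * y := by
          rw [pow_succ, ih]; group
      _ = x ^ n * (y ^ n * x) * z ^ n.choose 2 * y := by rw [hzx]; group
      _ = x ^ n * x * y ^ n * (z ^ (n + n.choose 2) * y) := by rw [hyn, pow_add]; group
      _ = _ := by rw [hzy, h2, pow_succ, pow_succ]; group

/-- In a finite `p`-group, a normal subgroup `K` whose elements of order dividing `p ^ 2` are
central has the property that elements in the same coset of `K` with the same `p`-th power differ
by an element of order dividing `p`. -/
theorem IsPGroup.div_pow_eq_one_of_pow_eq {p : ℕ} [Fact p.Prime] {H : Type*} [Group H] [Finite H]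
    (hH : IsPGroup p H) (K : Subgroup H) [K.Normal]
    (hK : ∀ k ∈ K, k ^ p ^ 2 = 1 → ∀ h, Commute k h) {u v : H} (huv : u ^ p = v ^ p)
    (hmem : u * v⁻¹ ∈ K) : (u * v⁻¹) ^ p = 1 := by
  induction hn : Nat.card H using Nat.strong_induction_on generalizing H with
  | _ n ih =>
  have of_commute (hc : Commute u v) : (u * v⁻¹) ^ p = 1 := by
    rw [hc.inv_right.mul_pow, huv, inv_pow, mul_inv_cancel]
  rcases eq_top_or_exists_le_coatom (zpowers u) with htop | ⟨M, hM, huM⟩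
  · obtain ⟨k, rfl⟩ := mem_zpowers_iff.1 (htop ▸ mem_top v : v ∈ zpowers u)
    exact of_commute ((Commute.refl u).zpow_right k)
  have hnil : Group.IsNilpotent H := hH.isNilpotent
  have hMn : M.Normal :=
    NormalizerCondition.normal_of_coatom M Group.normalizerCondition_of_isNilpotent hM
  have huM : u ∈ M := huM (mem_zpowers u)
  have hwM : v * u * v⁻¹ ∈ M := hMn.conj_mem u huM v
  have hcK : u * (v * u * v⁻¹)⁻¹ ∈ K := by
    have h1 : (u * v⁻¹) * (v * (u * v⁻¹)⁻¹ * v⁻¹) ∈ K :=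
      K.mul_mem hmem (Normal.conj_mem inferInstance _ (K.inv_mem hmem) v)
    convert h1 using 1
    group
  -- `u ^ p = v ^ p` commutes with `v`, so induction applies inside `M` to `u` and its conjugate.
  have hpow : u ^ p = (v * u * v⁻¹) ^ p := by
    rw [conj_pow, huv, ← pow_succ', pow_succ, mul_inv_cancel_right]
  have hcp : (u * (v * u * v⁻¹)⁻¹) ^ p = 1 := by
    have hlt : Nat.card M < n := by
      rw [← hn]
      refine lt_of_le_of_ne (card_le_card_group M) fun h => hM.1 (eq_top_of_card_eq M h)
    have := ih (Nat.card M) hlt (H := M) (hH.to_subgroup M) (K.subgroupOf M)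
      (fun k hk hk2 h => by
        have := hK k hk (by simpa using congrArg Subtype.val hk2) h
        exact Subtype.ext this)
      (u := ⟨u, huM⟩) (v := ⟨_, hwM⟩) (Subtype.ext (by simpa using hpow))
      (by simpa [mem_subgroupOf] using hcK) rfl
    simpa using congrArg Subtype.val this
  set c := u * (v * u * v⁻¹)⁻¹ with hc
  have hcc : ∀ h, Commute c h := hK c hcK (by rw [sq, pow_mul, hcp, one_pow])
  have hform : (u * v⁻¹) ^ p = c ^ (p.choose 2) := by
    have h1 : v⁻¹ * u = u * v⁻¹ * c := by
      have : v⁻¹ * u = u * v⁻¹ * (u⁻¹ * c * u) := by rw [hc]; group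
      rw [this, mul_assoc u⁻¹, (hcc u).eq, inv_mul_cancel_left]
    rw [mul_pow_of_central_commutator h1 (hcc _) (hcc _), huv, inv_pow, mul_inv_cancel, one_mul]
  -- For `p = 2` the factor `c ^ p.choose 2` is `c` itself and need not vanish. Only order dividing
  -- `p ^ 2` is known at this point, hence the form of `hK`.
  have hw : Commute (u * v⁻¹) v := hK _ hmem (by
    rw [sq, pow_mul, hform, ← pow_mul, mul_comm, pow_mul, hcp, one_pow]) v
  refine of_commute ?_
  have := hw.mul_left (Commute.refl v)
  simpa using this

/-! ### Central steps and Alperin's theorem. -/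

/-- A proper inclusion `N < B` of normal subgroups of a finite `p`-group can be refined by a normal
subgroup of order `p * |N|` that is generated by `N` and one element and is central modulo `N`. -/
theorem IsPGroup.exists_normal_sup_zpowers {p : ℕ} [hp : Fact p.Prime] {G : Type*} [Group G]
    [Finite G] (hG : IsPGroup p G) {N B : Subgroup G} [N.Normal] [B.Normal] (hNB : N < B) :
    ∃ h ∈ B, (N ⊔ zpowers h).Normal ∧ Nat.card ↥(N ⊔ zpowers h) = p * Nat.card N ∧
      ∀ x ∈ N ⊔ zpowers h, x ^ p ∈ N ∧ ∀ g, g * x * g⁻¹ * x⁻¹ ∈ N := by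
  set f := QuotientGroup.mk' N
  have hfN : f.ker = N := QuotientGroup.ker_mk' N
  have hQ : IsPGroup p (G ⧸ N) := hG.to_quotient N
  set M := B.map f
  have hMn : M.Normal := Normal.map inferInstance f (QuotientGroup.mk'_surjective N)
  have hM : M ≠ ⊥ := by
    intro h
    rw [Subgroup.map_eq_bot_iff, hfN] at h
    exact hNB.not_ge h
  have hMnt : Nontrivial M := (nontrivial_iff_ne_bot M).2 hM
  have hpM : p ∣ Nat.card M :=
    (hQ.to_subgroup M).card_eq_or_dvd.resolve_left Finite.one_lt_card.ne'
  have hQ' : IsPGroup p (ConjAct (G ⧸ N)) := hQ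
  obtain ⟨b, hb, hb1⟩ := hQ'.exists_fixed_point_of_prime_dvd_card_of_fixed_point M hpM
    (a := 1) (fun g => smul_one g)
  have hbc : (b : G ⧸ N) ∈ center (G ⧸ N) := by
    rw [mem_center_iff]
    intro g
    have := congrArg Subtype.val (hb (ConjAct.toConjAct g))
    rw [ConjAct.Subgroup.val_conj_smul, ConjAct.toConjAct_smul] at this
    exact mul_inv_eq_iff_eq_mul.1 this
  have hnt : Nontrivial ↥(M ⊓ center (G ⧸ N)) := by
    refine (nontrivial_iff_ne_bot _).2 fun h => hb1 ?_
    have : (b : G ⧸ N) ∈ M ⊓ center (G ⧸ N) := ⟨b.2, hbc⟩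
    rw [h, mem_bot] at this
    exact (Subtype.ext this).symm
  obtain ⟨⟨t, htM, htc⟩, ht⟩ := exists_prime_orderOf_dvd_card' p
    ((hQ.to_subgroup (M ⊓ center (G ⧸ N))).card_eq_or_dvd.resolve_left Finite.one_lt_card.ne')
  rw [← orderOf_coe] at ht
  obtain ⟨h, hhB, hft⟩ := htM
  have hcomap : N ⊔ zpowers h = (zpowers t).comap f := by
    rw [← hft, ← MonoidHom.map_zpowers, comap_map_eq, hfN, sup_comm]
  have hzc : zpowers t ≤ center (G ⧸ N) := zpowers_le.2 htc
  refine ⟨h, hhB, ?_, ?_, ?_⟩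
  · have : (zpowers t).Normal := ⟨fun x hx g => by
      rwa [mem_center_iff.1 (hzc hx) g, mul_inv_cancel_right]⟩
    rw [hcomap]
    infer_instance
  · have h1 := card_mul_index (N.subgroupOf (N ⊔ zpowers h))
    have h2 : (N.subgroupOf (N ⊔ zpowers h)).index = p := by
      have h3 : f.ker.relIndex (N ⊔ zpowers h) = p := by
        rw [relIndex_ker, hcomap, map_comap_eq_self_of_surjective (QuotientGroup.mk'_surjective N),
          Nat.card_zpowers, ht]
      rwa [hfN] at h3
    rw [h2, Nat.card_congr (subgroupOfEquivOfLe le_sup_left).toEquiv] at h1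
    rw [← h1, mul_comm]
  · intro x hx
    rw [hcomap, mem_comap] at hx
    have hxc := mem_center_iff.1 (hzc hx)
    refine ⟨?_, fun g => ?_⟩
    · rw [← hfN, MonoidHom.mem_ker, map_pow]
      obtain ⟨k, hk⟩ := mem_zpowers_iff.1 hx
      have : t ^ p = 1 := by rw [← ht]; exact pow_orderOf_eq_one t
      rw [← hk, ← zpow_natCast, ← zpow_mul, mul_comm, zpow_mul, zpow_natCast, this, one_zpow]
    · rw [← hfN, MonoidHom.mem_ker]
      simp only [map_mul, map_inv]
      rw [hxc]
      group

/-- Adjoining to a maximal normal abelian subgroup of exponent `m` a centralizing element of order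
dividing `m` that is central modulo the subgroup yields nothing new. -/
theorem IsMaximalNormalAbelianOfExponent.mem_of_commutator_mem {G : Type*} [Group G]
    {A : Subgroup G} {m : ℕ} (hA : IsMaximalNormalAbelianOfExponent A m) {x : G}
    (hxA : x ∈ centralizer (A : Set G)) (hxm : x ^ m = 1) (hx : ∀ g, x⁻¹ * (g * x * g⁻¹) ∈ A) :
    x ∈ A := by
  have hAn : A.Normal := hA.1.1
  have hAc : ∀ a ∈ A, ∀ b ∈ A, Commute a b := fun a ha b hb =>
    congrArg Subtype.val (isMulCommutative_iff.1 hA.1.2.1 ⟨a, ha⟩ ⟨b, hb⟩)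
  have hxc : ∀ a ∈ A, Commute a x := fun a ha => mem_centralizer_iff.1 hxA a ha
  have hle : A ≤ A ⊔ zpowers x := le_sup_left
  have mem_iff : ∀ y, y ∈ A ⊔ zpowers x ↔ ∃ a ∈ A, ∃ k : ℤ, a * x ^ k = y := by
    intro y
    rw [mem_sup_of_normal_left]
    constructor
    · rintro ⟨a, ha, _, ⟨k, rfl⟩, rfl⟩
      exact ⟨a, ha, k, rfl⟩
    · rintro ⟨a, ha, k, rfl⟩
      exact ⟨a, ha, _, ⟨k, rfl⟩, rfl⟩
  refine hA.2 (y := A ⊔ zpowers x) ⟨⟨?_⟩, ?_, ?_⟩ hle (mem_sup_right (mem_zpowers x))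
  · intro y hy g
    obtain ⟨a, ha, k, rfl⟩ := (mem_iff y).1 hy
    have h1 : g * (a * x ^ k) * g⁻¹ = (g * a * g⁻¹) * (x * (x⁻¹ * (g * x * g⁻¹))) ^ k := by
      rw [mul_inv_cancel_left, conj_zpow]
      group
    rw [h1]
    exact mul_mem (hle (hAn.conj_mem a ha g)) (zpow_mem
      (mul_mem (mem_sup_right (mem_zpowers x)) (hle (hx g))) k)
  · refine isMulCommutative_iff.2 ?_
    rintro ⟨y, hy⟩ ⟨z, hz⟩
    obtain ⟨a, ha, k, rfl⟩ := (mem_iff y).1 hy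
    obtain ⟨b, hb, l, rfl⟩ := (mem_iff z).1 hz
    have h1 : Commute a (b * x ^ l) := (hAc a ha b hb).mul_right ((hxc a ha).zpow_right l)
    have h2 : Commute (x ^ k) (b * x ^ l) :=
      (((hxc b hb).zpow_right k).symm).mul_right (((Commute.refl x).zpow_left k).zpow_right l)
    exact Subtype.ext (h1.mul_left h2)
  · refine Nat.dvd_antisymm (Monoid.exponent_dvd_of_forall_pow_eq_one ?_) ?_
    · rintro ⟨y, hy⟩
      obtain ⟨a, ha, k, rfl⟩ := (mem_iff y).1 hy
      have ha1 : a ^ m = 1 := by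
        have := Monoid.pow_exponent_eq_one (⟨a, ha⟩ : A)
        rw [hA.1.2.2] at this
        exact congrArg Subtype.val this
      refine Subtype.ext ?_
      change (a * x ^ k) ^ m = 1
      rw [((hxc a ha).zpow_right k).mul_pow, ha1, one_mul, ← zpow_natCast, ← zpow_mul, mul_comm,
        zpow_mul, zpow_natCast, hxm, one_zpow]
    · rw [← hA.1.2.2]
      exact Monoid.exponent_dvd_of_monoidHom (inclusion hle) (inclusion_injective hle)

/-- **Alperin's theorem**: a maximal normal abelian subgroup `A` of exponent `p ^ s > p` of a finite
`p`-group contains every element of its centralizer of order dividing `p ^ s`. -/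
theorem IsMaximalNormalAbelianOfExponent.mem_of_pow_eq_one {p : ℕ} [hp : Fact p.Prime] {G : Type*}
    [Group G] [Finite G] (hG : IsPGroup p G) {A : Subgroup G} {s : ℕ} (hs : 2 ≤ s)
    (hA : IsMaximalNormalAbelianOfExponent A (p ^ s)) {x : G}
    (hxA : x ∈ centralizer (A : Set G)) (hx : x ^ p ^ s = 1) : x ∈ A := by
  have hAn : A.Normal := hA.1.1
  set C := centralizer (A : Set G) with hC
  have hCn : C.Normal := inferInstance
  have hAC : ∀ a ∈ A, ∀ c ∈ C, Commute a c := fun a ha c hc => mem_centralizer_iff.1 hc a ha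
  have hAleC : A ≤ C := fun a ha => mem_centralizer_iff.2 fun b hb =>
    congrArg Subtype.val (isMulCommutative_iff.1 hA.1.2.1 ⟨b, hb⟩ ⟨a, ha⟩)
  by_contra hxnot
  -- `K` is a largest normal subgroup of `G` inside `C` satisfying the conclusion. One step above it
  -- there is a counterexample `y`, and `A ⊔ zpowers y` will contradict the maximality of `A`.
  obtain ⟨K, -, ⟨⟨hKn, hKC, hKA⟩, hKmax⟩⟩ := Set.Finite.exists_le_maximal
    (s := {K : Subgroup G | K.Normal ∧ K ≤ C ∧ ∀ k ∈ K, k ^ p ^ s = 1 → k ∈ A}) (Set.toFinite _)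
    (a := A) ⟨hAn, hAleC, fun k hk _ => hk⟩
  have hlt : K < C := lt_of_le_of_ne hKC fun h => hxnot (hKA x (h ▸ hxA) hx)
  obtain ⟨h, hhC, hHn, hHcard, hH⟩ := hG.exists_normal_sup_zpowers hlt
  set H := K ⊔ zpowers h with hHdef
  have hHC : H ≤ C := sup_le hKC (zpowers_le.2 hhC)
  have hKH : K ≤ H := le_sup_left
  have hbad : ∃ y ∈ H, y ^ p ^ s = 1 ∧ y ∉ A := by
    by_contra! hcon
    have hle : H ≤ K := hKmax ⟨hHn, hHC, hcon⟩ hKH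
    have := congrArg (fun L : Subgroup G => Nat.card L) (le_antisymm hle hKH)
    simp only [hHcard] at this
    have h2 := Nat.card_pos (α := K)
    have h3 := hp.out.one_lt
    nlinarith
  obtain ⟨y, hyH, hy1, hyA⟩ := hbad
  have hpA : ∀ k ∈ K, k ^ p = 1 → k ∈ A := fun k hk hk1 => hKA k hk (by
    obtain ⟨t, rfl⟩ : ∃ t, s = t + 1 := ⟨s - 1, by omega⟩
    rw [pow_succ', pow_mul, hk1, one_pow])
  have hypA : y ^ p ∈ A := hKA _ (hH y hyH).1 (by
    rw [← pow_mul, mul_comm, pow_mul, hy1, one_pow])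
  have hyK : ∀ k ∈ K, (y * k * y⁻¹ * k⁻¹) ^ p = 1 ∧ y * k * y⁻¹ * k⁻¹ ∈ A := by
    intro k hk
    have hcK : y * k * y⁻¹ * k⁻¹ ∈ K := K.mul_mem (hKn.conj_mem k hk y) (K.inv_mem hk)
    have heq : y * (k * y * k⁻¹)⁻¹ = y * k * y⁻¹ * k⁻¹ := by group
    have hpow : y ^ p = (k * y * k⁻¹) ^ p := by
      rw [conj_pow, ← (hAC _ hypA k (hKC hk)).eq, mul_inv_cancel_right]
    have := IsPGroup.div_pow_eq_one_of_pow_eq (hG.to_subgroup H) (K.subgroupOf H)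
      (fun l hl hl1 g => Subtype.ext (hAC l (hKA l hl (by
          obtain ⟨t, rfl⟩ : ∃ t, s = 2 + t := ⟨s - 2, by omega⟩
          have hl1 : (l : G) ^ p ^ 2 = 1 := by simpa using congrArg Subtype.val hl1
          rw [pow_add, pow_mul, hl1, one_pow])) g (hHC g.2)))
      (u := ⟨y, hyH⟩) (v := ⟨k * y * k⁻¹, hHn.conj_mem y hyH k⟩)
      (Subtype.ext (by simpa using hpow)) (by
        change y * (k * y * k⁻¹)⁻¹ ∈ K
        rwa [heq])
    have h1 : (y * k * y⁻¹ * k⁻¹) ^ p = 1 := by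
      rw [← heq]
      simpa using congrArg Subtype.val this
    exact ⟨h1, hpA _ hcK h1⟩
  refine hyA (hA.mem_of_commutator_mem (hHC hyH) hy1 fun g => ?_)
  -- `y * c` is a conjugate of `y`, so `(y * c) ^ p ^ s = 1`; expanding this power yields `c ^ p ^ s
  -- = 1`, hence `c ∈ A`.
  set c := y⁻¹ * (g * y * g⁻¹) with hcdef
  have hcK : c ∈ K := by
    have := hKn.conj_mem _ ((hH y hyH).2 g) y⁻¹
    convert this using 1
    rw [hcdef]; group
  obtain ⟨ha1, haA⟩ := hyK c⁻¹ (K.inv_mem hcK)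
  set a := y * c⁻¹ * y⁻¹ * c⁻¹⁻¹ with hadef
  have hcy : c * y = y * c * a := by
    have h1 : a = y⁻¹ * a * y := by
      rw [mul_assoc, (hAC a haA y (hHC hyH)).eq, inv_mul_cancel_left]
    rw [h1, hadef]; group
  have hyc : (y * c) ^ p ^ s = 1 := by
    rw [hcdef, mul_inv_cancel_left, conj_pow, hy1, mul_one, mul_inv_cancel]
  -- For `p = 2` this needs `s ≥ 2`.
  have hdvd : p ∣ (p ^ s).choose 2 := hp.out.dvd_choose_pow two_ne_zero (by
    have h1 := hp.out.two_le
    have : p ^ 2 ≤ p ^ s := Nat.pow_le_pow_right (by omega) hs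
    nlinarith)
  obtain ⟨q, hq⟩ := hdvd
  rw [mul_pow_of_central_commutator hcy (hAC a haA y (hHC hyH)) (hAC a haA c (hKC hcK)), hy1, hq,
    pow_mul, ha1, one_pow, one_mul, mul_one] at hyc
  exact hKA c hcK hyc

/-! ### Bounding the index and the order of the centralizer. -/

/-- The index counts the conjugates of `h`, and these all lie in the coset `N h`. -/
theorem Subgroup.index_centralizer_singleton_le {G : Type*} [Group G] [Finite G] (N : Subgroup G)
    {h : G} (hN : ∀ g, g * h * g⁻¹ * h⁻¹ ∈ N) : (centralizer {h}).index ≤ Nat.card N := by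
  refine Nat.card_le_card_of_injective
    (fun q : G ⧸ centralizer {h} => (⟨q.out * h * q.out⁻¹ * h⁻¹, hN _⟩ : N)) fun q q' hqq' => ?_
  have h1 : q.out * h * q.out⁻¹ = q'.out * h * q'.out⁻¹ :=
    mul_right_cancel (congrArg Subtype.val hqq')
  rw [← q.out_eq', ← q'.out_eq']
  refine QuotientGroup.eq.2 (mem_centralizer_singleton_iff.2 ?_)
  have h2 : h = q.out⁻¹ * (q'.out * h * q'.out⁻¹) * q.out := by rw [← h1]; group
  calc _ = (q.out⁻¹ * (q'.out * h * q'.out⁻¹) * q.out) * (q.out⁻¹ * q'.out) := by group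
    _ = _ := by rw [← h2]

/-- `T` is generated by one element per central step from `N` up to `B`; the generator of step `i`
has at most `p ^ i * |N|` conjugates. `T` need only generate `B` together with `N`: for `N = A^p`
this already gives `T = A`. -/
theorem IsPGroup.exists_index_centralizer_le {p : ℕ} [hp : Fact p.Prime] {G : Type*} [Group G]
    [Finite G] (hG : IsPGroup p G) {B : Subgroup G} [B.Normal] (k : ℕ) (N : Subgroup G) [N.Normal]
    (hNB : N ≤ B) (hcard : Nat.card B = p ^ k * Nat.card N) :
    ∃ T ≤ B, B ≤ N ⊔ T ∧
      (centralizer (T : Set G)).index ≤ ∏ i ∈ Finset.range k, (p ^ i * Nat.card N) := by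
  induction k generalizing N with
  | zero =>
    refine ⟨⊥, bot_le, ?_, ?_⟩
    · rw [sup_bot_eq]
      exact (eq_of_le_of_card_ge hNB (by simp [hcard])).ge
    · have : centralizer ((⊥ : Subgroup G) : Set G) = ⊤ := by
        ext x; simp [mem_centralizer_iff]
      rw [this, index_top, Finset.range_zero, Finset.prod_empty]
  | succ k ih =>
    have hlt : N < B := lt_of_le_of_ne hNB fun h => by
      have h1 : 1 < p ^ (k + 1) := Nat.one_lt_pow (by omega) hp.out.one_lt
      have h2 := Nat.card_pos (α := N)
      rw [← h] at hcard
      nlinarith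
    obtain ⟨h, hhB, hn, hc, hcom⟩ := hG.exists_normal_sup_zpowers hlt
    obtain ⟨T, hTB, hBT, hT⟩ := ih (N ⊔ zpowers h) (sup_le hNB (zpowers_le.2 hhB)) (by
      rw [hc, hcard]; ring)
    refine ⟨zpowers h ⊔ T, sup_le (zpowers_le.2 hhB) hTB, by rwa [← sup_assoc], ?_⟩
    have hle : centralizer {h} ⊓ centralizer (T : Set G) ≤
        centralizer ((zpowers h ⊔ T : Subgroup G) : Set G) := by
      rw [le_centralizer_iff]
      refine sup_le (zpowers_le.2 ?_) (le_centralizer_iff.1 inf_le_right)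
      exact mem_centralizer_iff.2 fun x hx => mem_centralizer_singleton_iff.1 hx.1
    calc _ ≤ (centralizer {h} ⊓ centralizer (T : Set G)).index := index_antitone hle
      _ ≤ (centralizer {h}).index * (centralizer (T : Set G)).index := index_inf_le
      _ ≤ Nat.card N * ∏ i ∈ Finset.range k, (p ^ i * Nat.card ↥(N ⊔ zpowers h)) :=
        Nat.mul_le_mul (index_centralizer_singleton_le N fun g =>
          (hcom h (mem_sup_right (mem_zpowers h))).2 g) hT
      _ = _ := by
        rw [Finset.prod_range_succ', hc, pow_zero, one_mul, mul_comm]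
        simp only [pow_succ, mul_assoc]

/-- A subgroup that generates a commutative group of finite exponent `p ^ s` together with the
`p`-th powers is the whole group. -/
theorem Subgroup.eq_top_of_powMonoidHom_range_sup_eq_top {A : Type*} [CommGroup A] {p s : ℕ}
    (hexp : ∀ a : A, a ^ p ^ s = 1) {T : Subgroup A} (hT : (powMonoidHom p : A →* A).range ⊔ T = ⊤) :
    T = ⊤ := by
  have key : ∀ k : ℕ, ∀ a : A, ∃ b, ∃ t ∈ T, b ^ p ^ k * t = a := by
    intro k
    induction k with
    | zero => exact fun a => ⟨a, 1, one_mem T, by simp⟩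
    | succ k ih =>
      intro a
      obtain ⟨b, t, ht, rfl⟩ := ih a
      obtain ⟨_, ⟨c, rfl⟩, t', ht', rfl⟩ := mem_sup.1 (hT ▸ mem_top b)
      refine ⟨c, t' ^ p ^ k * t, mul_mem (pow_mem ht' _) ht, ?_⟩
      rw [powMonoidHom_apply, mul_pow, ← pow_mul, pow_succ', mul_assoc]
  refine eq_top_iff.2 fun a _ => ?_
  obtain ⟨b, t, ht, rfl⟩ := key s a
  rwa [hexp, one_mul]

/-- By `hH`, right division by a fixed member embeds each nonempty fibre of `x ↦ x ^ p` into the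
solutions of `x ^ p = 1`; this is used `j` times. -/
theorem card_pow_eq_one_le {H : Type*} [Group H] [Finite H] {p : ℕ}
    (hH : ∀ u v : H, u ^ p = v ^ p → (u * v⁻¹) ^ p = 1) (i j : ℕ) :
    Nat.card {x : H // x ^ p ^ (i + j) = 1} ≤
      Nat.card {x : H // x ^ p = 1} ^ j * Nat.card {x : H // x ^ p ^ i = 1} := by
  classical
  have := Fintype.ofFinite H
  induction j with
  | zero => simp
  | succ j ih =>
    have step : Nat.card {x : H // x ^ p ^ (i + (j + 1)) = 1} ≤
        Nat.card {x : H // x ^ p = 1} * Nat.card {x : H // x ^ p ^ (i + j) = 1} := by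
      simp only [Nat.card_eq_fintype_card, Fintype.card_subtype]
      refine Finset.card_le_mul_card_image_of_maps_to (f := fun x => x ^ p) ?_ _ ?_
      · intro x hx
        simp only [Finset.mem_filter, Finset.mem_univ, true_and] at hx ⊢
        rw [← pow_mul, ← pow_succ', ← hx, add_assoc]
      · intro b _
        rcases Finset.eq_empty_or_nonempty
          {a ∈ ({x | x ^ p ^ (i + (j + 1)) = 1} : Finset H) | a ^ p = b} with h0 | ⟨a₀, ha₀⟩
        · rw [h0]; simp
        · refine Finset.card_le_card_of_injOn (fun a => a * a₀⁻¹) ?_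
            (fun a _ b _ hab => mul_right_cancel hab)
          intro a ha
          simp only [Finset.coe_filter, Finset.mem_filter, Finset.mem_univ, true_and,
            Set.mem_ofPred_eq] at ha ha₀ ⊢
          exact hH a a₀ (ha.2.trans ha₀.2.symm)
    refine step.trans ((Nat.mul_le_mul_left _ ih).trans (le_of_eq ?_))
    ring

/-- The centralizer of a normal abelian subgroup `A` of rank `d` of a finite `p`-group has index at
most `p ^ (∑ i < d, (m + i))`, where `p ^ m` is the number of `p`-th powers in `A`. -/
theorem IsPGroup.exists_index_centralizer_le_of_isMulCommutative {p : ℕ} [hp : Fact p.Prime]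
    {G : Type*} [Group G] [Finite G] (hG : IsPGroup p G) {A : Subgroup G} [hAn : A.Normal]
    (hA : IsMulCommutative A) :
    ∃ m d, Nat.card {a : A // a ^ p = 1} = p ^ d ∧ Nat.card A = p ^ (m + d) ∧
      Monoid.exponent A ∣ p ^ (m + 1) ∧
      (centralizer (A : Set G)).index ≤ ∏ i ∈ Finset.range d, (p ^ i * p ^ m) := by
  let _ : CommGroup A := { (inferInstance : Group A) with mul_comm := isMulCommutative_iff.1 hA }
  set f : A →* A := powMonoidHom p with hf
  have hAp : IsPGroup p A := hG.to_subgroup A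
  obtain ⟨d, hd⟩ := IsPGroup.iff_card.1 (hAp.to_subgroup f.ker)
  obtain ⟨m, hm⟩ := IsPGroup.iff_card.1 (hAp.to_subgroup f.range)
  obtain ⟨r, hr⟩ := IsPGroup.iff_card.1 hAp
  have hcard : Nat.card A = p ^ (m + d) := by
    rw [← card_mul_index f.ker, index_ker, hd, hm, pow_add, mul_comm]
  set P := f.range.map A.subtype with hP
  have hPcard : Nat.card P = p ^ m := by
    rw [← hm]
    exact Nat.card_congr (f.range.equivMapOfInjective A.subtype A.subtype_injective).symm.toEquiv
  have hPA : P ≤ A := map_subtype_le _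
  have hPn : P.Normal := by
    refine ⟨?_⟩
    rintro _ ⟨_, ⟨a, rfl⟩, rfl⟩ g
    refine ⟨_, ⟨⟨g * a * g⁻¹, hAn.conj_mem a a.2 g⟩, rfl⟩, ?_⟩
    simp [hf, conj_pow]
  obtain ⟨T, hTA, hAT, hT⟩ := hG.exists_index_centralizer_le (B := A) d P hPA (by
    rw [hcard, hPcard]; ring)
  have htop : f.range ⊔ T.subgroupOf A = ⊤ := by
    refine eq_top_iff.2 fun a _ => ?_
    obtain ⟨_, ⟨b, hb, rfl⟩, t, ht, hbt⟩ := mem_sup_of_normal_left.1 (hAT a.2)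
    have : b * ⟨t, hTA ht⟩ = a := Subtype.ext hbt
    rw [← this]
    exact mul_mem_sup hb ht
  have hTtop := eq_top_of_powMonoidHom_range_sup_eq_top (s := r)
    (fun a => by rw [← hr]; exact pow_card_eq_one') htop
  have hTeq : T = A := le_antisymm hTA (subgroupOf_eq_top.1 hTtop)
  refine ⟨m, d, ?_, hcard, Monoid.exponent_dvd_of_forall_pow_eq_one fun a => ?_, ?_⟩
  · rw [← hd]
    rfl
  · have : (⟨f a, a, rfl⟩ : f.range) ^ p ^ m = 1 := by rw [← hm]; exact pow_card_eq_one'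
    rw [pow_succ', pow_mul]
    simpa [hf] using congrArg Subtype.val this
  · rw [← hTeq, ← hPcard]
    exact hT

/-! ### The two inequalities. -/

theorem theoremC {G : Type*} [Group G] (p : ℕ) (hp : p.Prime) (n e s r : ℕ)
    (hG : Nat.card G = p ^ n) (hexp : Monoid.exponent G = p ^ e) (hs : 2 ≤ s)
    (A : Subgroup G) (hA : IsMaximalNormalAbelianOfExponent A (p ^ s))
    (hr : Nat.card A = p ^ r) :
    (n : ℝ) ≤ 1 / 2 * ((r : ℝ) - s + 1) * ((r : ℝ) - s + 2 * e - 2) + r ∧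
      -((e : ℝ) - s + 1 / 2) + Real.sqrt (((e : ℝ) - s + 1 / 2) ^ 2 + 2 * n) ≤ (r : ℝ) := by
  have : Fact p.Prime := ⟨hp⟩
  have hfin : Finite G := Nat.finite_of_card_ne_zero (by rw [hG]; exact pow_ne_zero _ hp.ne_zero)
  have hpG : IsPGroup p G := IsPGroup.of_card hG
  have hAn : A.Normal := hA.1.1
  obtain ⟨m, d, hd, hmd, hexpA, hindex⟩ :=
    hpG.exists_index_centralizer_le_of_isMulCommutative hA.1.2.1
  have hmr : m + d = r := Nat.pow_right_injective hp.two_le (hmd.symm.trans hr)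
  have hsm : s ≤ m + 1 := (Nat.pow_dvd_pow_iff_le_right hp.one_lt).1 (hA.1.2.2 ▸ hexpA)
  have hse : s ≤ e := by
    refine (Nat.pow_dvd_pow_iff_le_right hp.one_lt).1 ?_
    rw [← hA.1.2.2, ← hexp]
    exact Monoid.exponent_dvd_of_monoidHom A.subtype A.subtype_injective
  set C := centralizer (A : Set G) with hC
  have hmemA : ∀ (x : C) (k : ℕ), k ≤ s → x ^ p ^ k = 1 → (x : G) ∈ A := fun x k hk hx =>
    hA.mem_of_pow_eq_one hpG hs x.2 (by
      obtain ⟨t, rfl⟩ := Nat.exists_eq_add_of_le hk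
      have hx : (x : G) ^ p ^ k = 1 := by simpa using congrArg Subtype.val hx
      rw [pow_add, pow_mul, hx, one_pow])
  have hmemA' : ∀ x : C, x ^ p = 1 → (x : G) ∈ A := fun x hx =>
    hmemA x 1 (by omega) (by rwa [pow_one])
  have hCcard : Nat.card C ≤ (p ^ d) ^ (e - s) * p ^ r := by
    have h1 := card_pow_eq_one_le (H := C) (p := p) (fun u v huv =>
      (hpG.to_subgroup C).div_pow_eq_one_of_pow_eq ⊤ (fun k _ hk h =>
        Subtype.ext (mem_centralizer_iff.1 h.2 k (hmemA k 2 hs hk))) huv (mem_top _)) s (e - s)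
    have h2 : Nat.card {x : C // x ^ p ^ (s + (e - s)) = 1} = Nat.card C := by
      refine Nat.card_congr (Equiv.subtypeUnivEquiv fun x => ?_)
      rw [Nat.add_sub_cancel' hse, ← hexp]
      exact Subtype.ext (by simpa using Monoid.pow_exponent_eq_one (x : G))
    have h3 : Nat.card {x : C // x ^ p = 1} ≤ p ^ d := by
      rw [← hd]
      refine Nat.card_le_card_of_injective (fun x => ⟨⟨x.1, hmemA' x.1 x.2⟩, ?_⟩) ?_
      · exact Subtype.ext (by simpa using congrArg Subtype.val x.2)
      · intro x y hxy
        exact Subtype.ext (Subtype.ext (congrArg (fun a => ((a.1 : A) : G)) hxy))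
    have h4 : Nat.card {x : C // x ^ p ^ s = 1} ≤ p ^ r := by
      rw [← hr]
      refine Nat.card_le_card_of_injective (fun x => ⟨x.1, hmemA x.1 s le_rfl x.2⟩) ?_
      intro x y hxy
      exact Subtype.ext (Subtype.ext (congrArg (fun a : A => (a : G)) hxy))
    rw [← h2]
    exact h1.trans (Nat.mul_le_mul (Nat.pow_le_pow_left h3 _) h4)
  have hn : n ≤ (∑ i ∈ Finset.range d, (i + m)) + (d * (e - s) + r) := by
    refine (Nat.pow_le_pow_iff_right hp.one_lt).1 ?_
    rw [← hG, ← index_mul_card C, pow_add, pow_add, pow_mul, ← Finset.prod_pow_eq_pow_sum]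
    simp only [pow_add]
    exact Nat.mul_le_mul hindex hCcard
  have hsum : ((∑ i ∈ Finset.range d, (i + m) : ℕ) : ℝ) = d * (d - 1) / 2 + d * m := by
    rw [Finset.sum_add_distrib]
    push_cast
    have : (∑ i ∈ Finset.range d, (i : ℝ)) = d * (d - 1) / 2 := by
      clear * -
      induction d with
      | zero => simp
      | succ d ih => rw [Finset.sum_range_succ, ih]; push_cast; ring
    rw [this]
    simp
  have hnR : (n : ℝ) ≤ d * (d - 1) / 2 + d * m + (d * (e - s) + r) := by
    have h1 : (n : ℝ) ≤ (((∑ i ∈ Finset.range d, (i + m)) + (d * (e - s) + r) : ℕ) : ℝ) := by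
      exact_mod_cast hn
    rwa [Nat.cast_add, hsum, Nat.cast_add, Nat.cast_mul, Nat.cast_sub hse] at h1
  -- Slack variables `t = m + 1 - s` and `q = e - s`. The first bound exceeds `hnR` by exactly
  -- `t(t-1)/2 + t(s-1) + tq`.
  obtain ⟨t, ht⟩ := Nat.exists_eq_add_of_le hsm
  obtain ⟨q, rfl⟩ := Nat.exists_eq_add_of_le hse
  have hmR : (m : ℝ) = s + t - 1 := by
    have : ((m + 1 : ℕ) : ℝ) = ((s + t : ℕ) : ℝ) := by rw [ht]
    push_cast at this
    linarith
  have hrR : (r : ℝ) = s + t - 1 + d := by rw [← hmr, Nat.cast_add, hmR]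
  have hsR : (2 : ℝ) ≤ s := by exact_mod_cast hs
  have hq0 : (0 : ℝ) ≤ q := Nat.cast_nonneg q
  have ht0 : (0 : ℝ) ≤ t := Nat.cast_nonneg t
  have ht1 : (0 : ℝ) ≤ t * (t - 1) := by
    rcases Nat.eq_zero_or_pos t with rfl | h
    · simp
    · have : (1 : ℝ) ≤ t := by exact_mod_cast h
      exact mul_nonneg ht0 (by linarith)
  have hfirst : (n : ℝ) ≤
      1 / 2 * ((r : ℝ) - s + 1) * ((r : ℝ) - s + 2 * (s + q : ℕ) - 2) + r := by
    refine hnR.trans ?_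
    rw [hmR, hrR]
    push_cast
    have h1 : 0 ≤ (t : ℝ) * (s - 1) := mul_nonneg ht0 (by linarith)
    have h2 : 0 ≤ (t : ℝ) * q := mul_nonneg ht0 hq0
    linarith
  refine ⟨hfirst, ?_⟩
  push_cast at hfirst ⊢
  have h1 : Real.sqrt (((s : ℝ) + q - s + 1 / 2) ^ 2 + 2 * n) ≤ r + q + 1 / 2 := by
    refine Real.sqrt_le_iff.2 ⟨by positivity, ?_⟩
    -- After squaring, this is the amount by which the first inequality is stronger than the second.
    have h2 : 0 ≤ ((s : ℝ) - 1) * (2 * (s + q) - 2 - s) := mul_nonneg (by linarith) (by linarith)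
    linarith
  linarith
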